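/- \textbf{Corollary (WETO resource theory convexity).} Let $\Omega$ be a finite set with elements labelled $1,\dots,|\Omega|$, and let $\mathbb P_\Omega$ be the set of probability distributions on $\Omega$. Let $d\in\mathbb P_\Omega$ with $d_i>0$ for all $i$. Let $d^\downarrow$ denote the non-increasing rearrangement of $d$ and let $Q$ be a permutation matrix with $d^\downarrow=Qd$. For $1\le i<j\le|\Omega|$ let $P^{d^\downarrow}(i,j)$ be the matrix that coincides with the identity except on the rows and columns $i,j$, where it is $$\begin{pmatrix}1-\gamma_{i,j}&1\\ \gamma_{i,j}&0\end{pmatrix},\qquad \gamma_{i,j}=d^\downarrow_j/d^\downarrow_i ,$$ and let $P^{d^\downarrow}(i,i)=\mathbb I$. A \emph{$d$-swap} is a matrix $P^d(i,j)=Q^TP^{d^\downarrow}(i,j)\,Q$, and a \emph{$T^d$-transform} is a matrix $(1-\lambda)\mathbb I+\lambda P^d(i,j)$ with $0\le\lambda\le1$. For $p\in\mathbb P_\Omega$ let $\mathcal C_d^{WETO}(p)$ be the set of all $q\in\mathbb P_\Omega$ of the form $q=T_\ell\cdots T_1p$ with finitely many $T^d$-transforms $T_1,\dots,T_\ell$ (the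 distributions that can be achieved from $p$ by weak elementary thermal operations). Call $d$ \emph{quasi-uniform} if there are $x,y$ with $d_i\in\{x,y\}$ for all $i$. Then: (a) $\mathcal C_d^{WETO}(p)$ is convex for all $p\in\mathbb P_\Omega$ only if $d$ is quasi-uniform. (b) If $|\Omega|=3$, then $\mathcal C_d^{WETO}(p)$ is convex for all $p\in\mathbb P_\Omega$ if and only if $d$ is quasi-uniform. -/

import Mathlib

open scoped Matrix

/-- The two-level swap of levels `i` and `j` for a vector `e`: the matrix that is the identity
outside the rows and columns `i`, `j`, and whose block on `(i, j)` is
`!![1 - γ, 1; γ, 0]` with `γ = e j / e i`. For `i = j` it is the identity. -/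
noncomputable def swapMatrix {n : ℕ} (e : Fin n → ℝ) (i j : Fin n) :
    Matrix (Fin n) (Fin n) ℝ :=
  Matrix.of fun k l =>
    if i = j then (if k = l then 1 else 0)
    else if k = i ∧ l = i then 1 - e j / e i
    else if k = i ∧ l = j then 1
    else if k = j ∧ l = i then e j / e i
    else if k = j ∧ l = j then 0
    else if k = l then 1 else 0

/-- `P` is a `d`-swap: `P = Qᵀ * P_{d↓}(i, j) * Q` for some levels `i ≤ j`, where `Q` is a
permutation matrix such that `d↓ = Q d` is the non-increasing rearrangement of `d`. -/
def IsDSwap {n : ℕ} (d : Fin n → ℝ) (P : Matrix (Fin n) (Fin n) ℝ) : Prop :=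
  ∃ (σ : Equiv.Perm (Fin n)) (i j : Fin n),
    Antitone (σ.permMatrix ℝ *ᵥ d) ∧ i ≤ j ∧
      P = (σ.permMatrix ℝ)ᵀ * swapMatrix (σ.permMatrix ℝ *ᵥ d) i j * σ.permMatrix ℝ

/-- `T` is a `T^d`-transform: `T = (1 - t) • 1 + t • P` for a `d`-swap `P` and `0 ≤ t ≤ 1`. -/
def IsTdTransform {n : ℕ} (d : Fin n → ℝ) (T : Matrix (Fin n) (Fin n) ℝ) : Prop :=
  ∃ (P : Matrix (Fin n) (Fin n) ℝ) (t : ℝ), IsDSwap d P ∧ 0 ≤ t ∧ t ≤ 1 ∧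
    T = (1 - t) • (1 : Matrix (Fin n) (Fin n) ℝ) + t • P

/-- The probability distributions that can be achieved from `p` by weak elementary thermal
operations, that is, by sequentially applying finitely many `T^d`-transforms to `p`. -/
def wetoReachable {n : ℕ} (d p : Fin n → ℝ) : Set (Fin n → ℝ) :=
  {q | q ∈ stdSimplex ℝ (Fin n) ∧
    ∃ L : List (Matrix (Fin n) (Fin n) ℝ), (∀ T ∈ L, IsTdTransform d T) ∧ q = L.prod *ᵥ p}

/-- `d` is quasi-uniform: its entries take at most two different values. -/
def IsQuasiUniform {n : ℕ} (d : Fin n → ℝ) : Prop :=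
  ∃ x y : ℝ, ∀ i, d i = x ∨ d i = y

/-! A `T^d`-transform moves a fraction of a fixed linear flow between two levels, so reachability is
the reflexive transitive closure of such two-level steps.

If three levels have two equal weights, the reachable set is an explicit polytope. Its bounds are
the extreme populations obtained by swapping the odd level `s` with the two equal ones. The polytope
is stable under full swaps, hence by convexity under all steps; conversely, each of its points is
reached by setting the population of `s` first and then mixing the two equal levels
(`convex_setOf_reach_of_top`, `convex_setOf_reach_of_middle`).

If three weights `D > αD > αβD` occur, a suitable `p` on these levels reaches two points at which a
linear functional attains its maximum over an invariant region. This maximum is attained only by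
full swaps applied to vectors strictly below it, and these land on the two endpoints; so the
midpoint is unreachable (`EdgeRegion`). Further levels do not help: a step involving an empty level
does nothing, exchanges equal weights, or strictly raises the total weight of the occupied levels,
which never decreases (`EdgeConfig.of_reach`). -/

/-! ### Swaps and transforms as two-level steps. -/

/-- Two-level step towards the swap of the levels `i` and `j`: a `t`-fraction of the full flow is
moved from level `j` to level `i`. -/
noncomputable def levelStep {n : ℕ} (d : Fin n → ℝ) (i j : Fin n) (t : ℝ) (v : Fin n → ℝ) :
    Fin n → ℝ :=
  v + (t * (v j - d j / d i * v i)) • (Pi.single i 1 - Pi.single j 1)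

theorem swapMatrix_eq_add_vecMulVec {n : ℕ} (e : Fin n → ℝ) (i j : Fin n) :
    swapMatrix e i j = 1 + Matrix.vecMulVec (Pi.single i 1 - Pi.single j 1)
      (Pi.single j 1 - (e j / e i) • Pi.single i 1) := by
  ext k l
  by_cases hij : i = j
  · subst hij
    simp [swapMatrix, Matrix.vecMulVec, Matrix.one_apply]
  · simp only [swapMatrix, Matrix.vecMulVec, Matrix.of_apply, Matrix.add_apply, Matrix.one_apply,
      Pi.sub_apply, Pi.smul_apply, Pi.single_apply, smul_eq_mul, hij, if_false]
    by_cases hki : k = i <;> by_cases hkj : k = j <;> by_cases hli : l = i <;>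
      by_cases hlj : l = j <;> subst_vars <;> simp_all [eq_comm, sub_eq_add_neg]

theorem swapMatrix_mulVec {n : ℕ} (e : Fin n → ℝ) (i j : Fin n) (v : Fin n → ℝ) :
    swapMatrix e i j *ᵥ v = levelStep e i j 1 v := by
  rw [swapMatrix_eq_add_vecMulVec, Matrix.add_mulVec, Matrix.one_mulVec, Matrix.vecMulVec_mulVec]
  ext k
  simp only [levelStep, sub_dotProduct, smul_dotProduct, single_one_dotProduct, op_smul_eq_smul,
    smul_eq_mul, one_mul]

theorem levelStep_comp_perm {n : ℕ} (d : Fin n → ℝ) (σ : Equiv.Perm (Fin n)) (i j : Fin n) (t : ℝ)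
    (v : Fin n → ℝ) :
    levelStep (d ∘ σ) i j t (v ∘ σ) ∘ (σ⁻¹ : Equiv.Perm (Fin n)) = levelStep d (σ i) (σ j) t v := by
  ext k
  obtain ⟨l, rfl⟩ := σ.surjective k
  simp [levelStep, Pi.single_apply]

theorem levelStep_eq_smul_add {n : ℕ} (d : Fin n → ℝ) (i j : Fin n) (t : ℝ) (v : Fin n → ℝ) :
    levelStep d i j t v = (1 - t) • v + t • levelStep d i j 1 v := by
  ext k
  simp only [levelStep, Pi.add_apply, Pi.smul_apply, smul_eq_mul]
  ring

theorem levelStep_symm {n : ℕ} {d : Fin n → ℝ} {i j : Fin n} (h : d i = d j) (hi : d i ≠ 0) (t : ℝ)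
    (v : Fin n → ℝ) : levelStep d i j t v = levelStep d j i t v := by
  ext k
  simp only [levelStep, Pi.add_apply, Pi.smul_apply, smul_eq_mul, Pi.sub_apply, ← h, div_self hi]
  ring

theorem dSwap_mulVec {n : ℕ} (d : Fin n → ℝ) (σ : Equiv.Perm (Fin n)) (i j : Fin n)
    (v : Fin n → ℝ) :
    ((σ.permMatrix ℝ)ᵀ * swapMatrix (σ.permMatrix ℝ *ᵥ d) i j * σ.permMatrix ℝ) *ᵥ v =
      levelStep d (σ i) (σ j) 1 v := by
  rw [← Matrix.mulVec_mulVec, ← Matrix.mulVec_mulVec, swapMatrix_mulVec, Matrix.transpose_permMatrix,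
    Matrix.permMatrix_mulVec, Matrix.permMatrix_mulVec, Matrix.permMatrix_mulVec,
    levelStep_comp_perm]

theorem IsTdTransform.exists_levelStep {n : ℕ} {d : Fin n → ℝ} {T : Matrix (Fin n) (Fin n) ℝ}
    (hT : IsTdTransform d T) :
    ∃ i j t, d j ≤ d i ∧ 0 ≤ t ∧ t ≤ 1 ∧ ∀ v, T *ᵥ v = levelStep d i j t v := by
  obtain ⟨P, t, ⟨σ, i, j, hσ, hij, rfl⟩, h0, h1, rfl⟩ := hT
  refine ⟨σ i, σ j, t, ?_, h0, h1, fun v => ?_⟩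
  · simpa [Matrix.permMatrix_mulVec] using hσ hij
  · rw [Matrix.add_mulVec, Matrix.smul_mulVec, Matrix.smul_mulVec, Matrix.one_mulVec, dSwap_mulVec,
      ← levelStep_eq_smul_add]

/-- One sorting permutation serves all pairs. With ties it may order `i` and `j` the wrong way
round, but then the weights agree and the step is symmetric. -/
theorem exists_isTdTransform {n : ℕ} {d : Fin n → ℝ} (hpos : ∀ i, 0 < d i) {i j : Fin n} {t : ℝ}
    (hij : d j ≤ d i) (h0 : 0 ≤ t) (h1 : t ≤ 1) :
    ∃ T, IsTdTransform d T ∧ ∀ v, T *ᵥ v = levelStep d i j t v := by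
  obtain ⟨σ, hσ⟩ : ∃ σ : Equiv.Perm (Fin n), Antitone (d ∘ σ) := by
    refine ⟨Tuple.sort (-d), fun a b hab => ?_⟩
    have := Tuple.monotone_sort (-d) hab
    simpa using this
  have key : ∀ k l, σ.symm k ≤ σ.symm l →
      ∃ T, IsTdTransform d T ∧ ∀ v, T *ᵥ v = levelStep d k l t v := by
    intro k l hkl
    refine ⟨_, ⟨_, t, ⟨σ, σ.symm k, σ.symm l, ?_, hkl, rfl⟩, h0, h1, rfl⟩, fun v => ?_⟩
    · rwa [Matrix.permMatrix_mulVec]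
    · rw [Matrix.add_mulVec, Matrix.smul_mulVec, Matrix.smul_mulVec, Matrix.one_mulVec,
        dSwap_mulVec, ← levelStep_eq_smul_add, Equiv.apply_symm_apply, Equiv.apply_symm_apply]
  rcases le_total (σ.symm i) (σ.symm j) with h | h
  · exact key i j h
  · have hle : d i ≤ d j := by simpa using hσ h
    obtain ⟨T, hT, hv⟩ := key j i h
    exact ⟨T, hT, fun v => by rw [hv, levelStep_symm (le_antisymm hij hle) (hpos j).ne']⟩

/-! ### Reachability as a transitive closure. -/

/-- `Reach d p q`: finitely many two-level steps lead from the vector `p` to the vector `q`. -/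
def Reach {n : ℕ} (d : Fin n → ℝ) : (Fin n → ℝ) → (Fin n → ℝ) → Prop :=
  Relation.ReflTransGen fun v w =>
    ∃ i j t, d j ≤ d i ∧ 0 ≤ t ∧ t ≤ 1 ∧ w = levelStep d i j t v

theorem Reach.of_levelStep {n : ℕ} {d : Fin n → ℝ} {i j : Fin n} {t : ℝ} (hij : d j ≤ d i)
    (h0 : 0 ≤ t) (h1 : t ≤ 1) (v : Fin n → ℝ) : Reach d v (levelStep d i j t v) :=
  Relation.ReflTransGen.single ⟨i, j, t, hij, h0, h1, rfl⟩

theorem Reach.trans {n : ℕ} {d u v w : Fin n → ℝ} (h₁ : Reach d u v) (h₂ : Reach d v w) :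
    Reach d u w :=
  Relation.ReflTransGen.trans h₁ h₂

theorem levelStep_smul {n : ℕ} (d : Fin n → ℝ) (i j : Fin n) (t c : ℝ) (v : Fin n → ℝ) :
    levelStep d i j t (c • v) = c • levelStep d i j t v := by
  ext k
  simp only [levelStep, Pi.add_apply, Pi.smul_apply, smul_eq_mul]
  ring

/-- Steps are linear and `Reach` asks for no positivity, so negative `c` is allowed; the case `c =
-1` later exchanges hot and cold. -/
theorem Reach.smul {n : ℕ} {d v w : Fin n → ℝ} (h : Reach d v w) (c : ℝ) :
    Reach d (c • v) (c • w) := by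
  refine Relation.ReflTransGen.lift (c • ·) (fun v w h => ?_) v w h
  obtain ⟨i, j, t, hij, h0, h1, rfl⟩ := h
  exact ⟨i, j, t, hij, h0, h1, (levelStep_smul d i j t c v).symm⟩

theorem Reach.invariant {n : ℕ} {d p q : Fin n → ℝ} (I : (Fin n → ℝ) → Prop)
    (hstep : ∀ v i j t, d j ≤ d i → 0 ≤ t → t ≤ 1 → I v → I (levelStep d i j t v))
    (hp : I p) (h : Reach d p q) : I q := by
  induction h with
  | refl => exact hp
  | tail _ hs ih =>
    obtain ⟨i, j, t, hij, h0, h1, rfl⟩ := hs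
    exact hstep _ i j t hij h0 h1 ih

theorem reach_iff_exists_prod {n : ℕ} {d : Fin n → ℝ} (hpos : ∀ i, 0 < d i) (p q : Fin n → ℝ) :
    Reach d p q ↔
      ∃ L : List (Matrix (Fin n) (Fin n) ℝ), (∀ T ∈ L, IsTdTransform d T) ∧ q = L.prod *ᵥ p := by
  constructor
  · intro h
    induction h with
    | refl => exact ⟨[], by simp⟩
    | tail _ hs ih =>
      obtain ⟨i, j, t, hij, h0, h1, rfl⟩ := hs
      obtain ⟨L, hL, rfl⟩ := ih
      obtain ⟨T, hT, hTv⟩ := exists_isTdTransform hpos hij h0 h1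
      exact ⟨T :: L, by simpa [hT] using hL, by
        rw [List.prod_cons, ← Matrix.mulVec_mulVec, hTv]⟩
  · rintro ⟨L, hL, rfl⟩
    induction L with
    | nil => rw [List.prod_nil, Matrix.one_mulVec]; exact Relation.ReflTransGen.refl
    | cons T L ih =>
      obtain ⟨i, j, t, hij, h0, h1, hT⟩ := (hL T (by simp)).exists_levelStep
      rw [List.prod_cons, ← Matrix.mulVec_mulVec, hT]
      exact (ih fun T' hT' => hL T' (by simp [hT'])).trans (Reach.of_levelStep hij h0 h1 _)

theorem levelStep_apply_left {n : ℕ} (d : Fin n → ℝ) {i j : Fin n} (hij : i ≠ j) (t : ℝ)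
    (v : Fin n → ℝ) : levelStep d i j t v i = v i + t * (v j - d j / d i * v i) := by
  simp [levelStep, hij]

theorem levelStep_apply_right {n : ℕ} (d : Fin n → ℝ) {i j : Fin n} (hij : i ≠ j) (t : ℝ)
    (v : Fin n → ℝ) : levelStep d i j t v j = v j - t * (v j - d j / d i * v i) := by
  simp [levelStep, hij.symm, sub_eq_add_neg]

theorem levelStep_apply_of_ne {n : ℕ} (d : Fin n → ℝ) {i j k : Fin n} (hi : k ≠ i) (hj : k ≠ j)
    (t : ℝ) (v : Fin n → ℝ) : levelStep d i j t v k = v k := by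
  simp [levelStep, hi, hj]

theorem levelStep_self {n : ℕ} (d : Fin n → ℝ) (i : Fin n) (t : ℝ) (v : Fin n → ℝ) :
    levelStep d i i t v = v := by
  simp [levelStep]

theorem sum_levelStep {n : ℕ} (d : Fin n → ℝ) (i j : Fin n) (t : ℝ) (v : Fin n → ℝ) :
    ∑ k, levelStep d i j t v k = ∑ k, v k := by
  simp [levelStep, Finset.sum_add_distrib, ← Finset.mul_sum]

theorem levelStep_nonneg {n : ℕ} {d : Fin n → ℝ} (hpos : ∀ i, 0 < d i) {i j : Fin n} {t : ℝ}
    (hij : d j ≤ d i) (h0 : 0 ≤ t) (h1 : t ≤ 1) {v : Fin n → ℝ} (hv : ∀ k, 0 ≤ v k) (k : Fin n) :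
    0 ≤ levelStep d i j t v k := by
  have hγ0 : 0 ≤ d j / d i := (div_pos (hpos j) (hpos i)).le
  have hγ1 : d j / d i ≤ 1 := (div_le_one (hpos i)).2 hij
  rcases eq_or_ne i j with rfl | hne
  · rw [levelStep_self]; exact hv k
  by_cases hi : k = i
  · subst hi
    rw [levelStep_apply_left d hne]
    have e : v k + t * (v j - d j / d k * v k) = (1 - t * (d j / d k)) * v k + t * v j := by ring
    have := mul_le_one₀ h1 hγ0 hγ1
    rw [e]
    exact add_nonneg (mul_nonneg (by linarith) (hv k)) (mul_nonneg h0 (hv j))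
  by_cases hj : k = j
  · subst hj
    rw [levelStep_apply_right d hne]
    have e : v k - t * (v k - d k / d i * v i) = (1 - t) * v k + t * (d k / d i) * v i := by ring
    rw [e]
    exact add_nonneg (mul_nonneg (by linarith) (hv k)) (mul_nonneg (mul_nonneg h0 hγ0) (hv i))
  · rw [levelStep_apply_of_ne d hi hj]; exact hv k

theorem wetoReachable_eq_setOf_reach {n : ℕ} {d : Fin n → ℝ} (hpos : ∀ i, 0 < d i) {p : Fin n → ℝ}
    (hp : p ∈ stdSimplex ℝ (Fin n)) : wetoReachable d p = {q | Reach d p q} := by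
  ext q
  simp only [wetoReachable, Set.mem_ofPred_eq, ← reach_iff_exists_prod hpos]
  refine ⟨fun h => h.2, fun h => ⟨?_, h⟩⟩
  refine h.invariant (· ∈ stdSimplex ℝ (Fin n)) ?_ hp
  intro v i j t hij h0 h1 hv
  exact ⟨levelStep_nonneg hpos hij h0 h1 hv.1, by rw [sum_levelStep, hv.2]⟩

/-! ### The signed flow between two levels, symmetric in their order. -/

/-- The full flow from level `i` to level `j` of the swap of these two levels. -/
noncomputable def pairFlow {n : ℕ} (d : Fin n → ℝ) (i j : Fin n) (v : Fin n → ℝ) : ℝ :=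
  min (d i) (d j) * (v i / d i - v j / d j)

theorem pairFlow_swap {n : ℕ} (d : Fin n → ℝ) (i j : Fin n) (v : Fin n → ℝ) :
    pairFlow d j i v = -pairFlow d i j v := by
  rw [pairFlow, pairFlow, min_comm]
  ring

theorem levelStep_eq_pairFlow {n : ℕ} {d : Fin n → ℝ} (hpos : ∀ i, 0 < d i) {i j : Fin n}
    (hij : d j ≤ d i) (t : ℝ) (v : Fin n → ℝ) :
    levelStep d i j t v = v + (t * pairFlow d i j v) • (Pi.single j 1 - Pi.single i 1) := by
  have h1 : pairFlow d i j v = d j / d i * v i - v j := by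
    have := (hpos j).ne'
    have := (hpos i).ne'
    rw [pairFlow, min_eq_right hij]
    field_simp
  ext k
  simp only [levelStep, h1, Pi.add_apply, Pi.smul_apply, smul_eq_mul, Pi.sub_apply]
  ring

theorem exists_reach_of_flow {n : ℕ} {d : Fin n → ℝ} (hpos : ∀ i, 0 < d i) {i j : Fin n}
    (hij : i ≠ j) (v : Fin n → ℝ) {z : ℝ} (hz : z ∈ Set.uIcc 0 (pairFlow d i j v)) :
    ∃ w, Reach d v w ∧ w i = v i - z ∧ w j = v j + z ∧ ∀ k, k ≠ i → k ≠ j → w k = v k := by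
  obtain ⟨t, ⟨h0, h1⟩, rfl⟩ : ∃ t ∈ Set.Icc (0 : ℝ) 1, t * pairFlow d i j v = z := by
    rw [← segment_eq_uIcc, segment_eq_image] at hz
    obtain ⟨t, ht, rfl⟩ := hz
    exact ⟨t, ht, by simp⟩
  refine ⟨v + (t * pairFlow d i j v) • (Pi.single j 1 - Pi.single i 1), ?_, ?_, ?_, ?_⟩
  · rcases le_total (d j) (d i) with h | h
    · rw [← levelStep_eq_pairFlow hpos h]
      exact Reach.of_levelStep h h0 h1 v
    · have e : v + (t * pairFlow d i j v) • (Pi.single j 1 - Pi.single i 1) =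
          levelStep d j i t v := by
        rw [levelStep_eq_pairFlow hpos h, pairFlow_swap d i j]
        ext k
        simp only [Pi.add_apply, Pi.smul_apply, smul_eq_mul, Pi.sub_apply]
        ring
      rw [e]
      exact Reach.of_levelStep h h0 h1 v
  · simp [hij, sub_eq_add_neg]
  · simp [hij.symm]
  · intro k hi hj
    simp [hi, hj]

/-- A partial step is a convex combination of the identity and the full swap, so only full swaps
need checking. -/
theorem Reach.mem_of_convex {n : ℕ} {d p q : Fin n → ℝ} (hpos : ∀ i, 0 < d i)
    {R : Set (Fin n → ℝ)} (hR : Convex ℝ R)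
    (hstep : ∀ v ∈ R, ∀ i j w, i ≠ j → w i = v i - pairFlow d i j v → w j = v j + pairFlow d i j v →
      (∀ k, k ≠ i → k ≠ j → w k = v k) → w ∈ R)
    (hp : p ∈ R) (h : Reach d p q) : q ∈ R := by
  refine h.invariant (· ∈ R) ?_ hp
  intro v i j t hij h0 h1 hv
  rcases eq_or_ne i j with rfl | hne
  · rwa [levelStep_self]
  rw [levelStep_eq_smul_add]
  refine hR hv ?_ (by linarith) h0 (by ring)
  rw [levelStep_eq_pairFlow hpos hij]
  refine hstep v hv i j _ hne ?_ ?_ ?_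
  · simp [hne, sub_eq_add_neg]
  · simp [hne.symm]
  · intro k hi hj
    simp [hi, hj]

theorem Reach.neg {n : ℕ} {d v w : Fin n → ℝ} (h : Reach d v w) : Reach d (-v) (-w) := by
  simpa using h.smul (-1)

/-! ### Three levels, two of them of equal weight: the reachable set is a polytope. -/

/-- The vectors with total `S` whose entry at `s` lies in `[uL, uH]` and whose entries at `a`, `b`
lie in `[m, M]`. -/
def levelRegion (s a b : Fin 3) (S uL uH m M : ℝ) : Set (Fin 3 → ℝ) :=
  {q | q s + q a + q b = S ∧ q s ∈ Set.Icc uL uH ∧ q a ∈ Set.Icc m M ∧ q b ∈ Set.Icc m M}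

theorem convex_levelRegion (s a b : Fin 3) (S uL uH m M : ℝ) :
    Convex ℝ (levelRegion s a b S uL uH m M) := by
  rintro x ⟨h1, h2, h3, h4⟩ y ⟨k1, k2, k3, k4⟩ α β hα hβ hαβ
  refine ⟨?_, convex_Icc _ _ h2 k2 hα hβ hαβ, convex_Icc _ _ h3 k3 hα hβ hαβ,
    convex_Icc _ _ h4 k4 hα hβ hαβ⟩
  simp only [Pi.add_apply, Pi.smul_apply, smul_eq_mul]
  linear_combination α * h1 + β * k1 + S * hαβ

/-- After the swap the entries are `γ * s` at `a` and, eliminating `s` by the total, `(1 - γ) * (S -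
b) + γ * a` at `s`. Both are monotone in each variable, and `c1`–`c4` compare their extreme values
with the box. -/
theorem swap_mem_of_degenerate_smaller {γ S uL uH m M s a b : ℝ} (h0 : 0 ≤ γ) (h1 : γ ≤ 1)
    (c1 : m ≤ γ * uL) (c2 : γ * uH ≤ M) (c3 : (1 - γ) * (S - m) + γ * M ≤ uH)
    (c4 : uL ≤ (1 - γ) * (S - M) + γ * m) (hS : s + a + b = S) (hs : s ∈ Set.Icc uL uH)
    (ha : a ∈ Set.Icc m M) (hb : b ∈ Set.Icc m M) :
    s - (γ * s - 1 * a) ∈ Set.Icc uL uH ∧ a + (γ * s - 1 * a) ∈ Set.Icc m M := by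
  subst hS
  have h1' : 0 ≤ 1 - γ := by linarith
  have e1 := mul_nonneg h0 (sub_nonneg.2 hs.1)
  have e2 := mul_nonneg h0 (sub_nonneg.2 hs.2)
  have e3 := mul_nonneg h0 (sub_nonneg.2 ha.1)
  have e4 := mul_nonneg h0 (sub_nonneg.2 ha.2)
  have e5 := mul_nonneg h1' (sub_nonneg.2 hb.1)
  have e6 := mul_nonneg h1' (sub_nonneg.2 hb.2)
  refine ⟨⟨?_, ?_⟩, ⟨?_, ?_⟩⟩ <;> linarith

theorem swap_mem_of_degenerate_larger {γ S uL uH m M s a b : ℝ} (h0 : 0 ≤ γ) (h1 : γ ≤ 1)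
    (c1 : uL ≤ γ * m) (c2 : γ * M ≤ uH) (c3 : (1 - γ) * (S - m) + γ * uH ≤ M)
    (c4 : m ≤ (1 - γ) * (S - M) + γ * uL) (hS : s + a + b = S) (hs : s ∈ Set.Icc uL uH)
    (ha : a ∈ Set.Icc m M) (hb : b ∈ Set.Icc m M) :
    s - (1 * s - γ * a) ∈ Set.Icc uL uH ∧ a + (1 * s - γ * a) ∈ Set.Icc m M := by
  subst hS
  have h1' : 0 ≤ 1 - γ := by linarith
  have e1 := mul_nonneg h0 (sub_nonneg.2 hs.1)
  have e2 := mul_nonneg h0 (sub_nonneg.2 hs.2)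
  have e3 := mul_nonneg h0 (sub_nonneg.2 ha.1)
  have e4 := mul_nonneg h0 (sub_nonneg.2 ha.2)
  have e5 := mul_nonneg h1' (sub_nonneg.2 hb.1)
  have e6 := mul_nonneg h1' (sub_nonneg.2 hb.2)
  refine ⟨⟨?_, ?_⟩, ⟨?_, ?_⟩⟩ <;> linarith

/-- The box for `s` hotter than both equal levels: `x'` and `M` are the entries after swapping `s`
with the fuller level, `uL` is what remains at `s` after a further swap with the other one. -/
theorem swap_mem_of_top {A B x y z : ℝ} (hA0 : 0 < A) (hA1 : A ≤ 1) (hB0 : 0 < B) (hB1 : B ≤ 1)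
    (hAB : A = 1 ∨ B = 1) (hzy : z ≤ y) (hyx : B * y ≤ A * x) {x' uL M : ℝ}
    (hx' : x' = x - (A * x - B * y)) (hM : M = y + (A * x - B * y))
    (huL : uL = x' - (A * x' - B * z)) {s a b : ℝ} (hS : s + a + b = x + y + z)
    (hs : s ∈ Set.Icc uL x) (ha : a ∈ Set.Icc z M) (hb : b ∈ Set.Icc z M) :
    s - (A * s - B * a) ∈ Set.Icc uL x ∧ a + (A * s - B * a) ∈ Set.Icc z M := by
  subst hM huL hx'
  rcases hAB with rfl | rfl
  · have k1 := mul_nonneg (sub_nonneg.2 hB1) (sub_nonneg.2 hzy)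
    have k2 := mul_nonneg hB0.le (sub_nonneg.2 hzy)
    refine swap_mem_of_degenerate_larger hB0.le hB1 ?_ ?_ ?_ ?_ hS hs ha hb
    · nlinarith
    · nlinarith
    · nlinarith
    · nlinarith
  · have k1 := mul_nonneg (sub_nonneg.2 hA1) (sub_nonneg.2 hzy)
    have k2 := mul_nonneg hA0.le (sub_nonneg.2 hzy)
    have k3 := mul_nonneg (sub_nonneg.2 hA1) (sub_nonneg.2 hyx)
    refine swap_mem_of_degenerate_smaller hA0.le hA1 ?_ ?_ ?_ ?_ hS hs ha hb
    · nlinarith [mul_nonneg hA0.le k1, mul_nonneg hA0.le k3]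
    · nlinarith
    · nlinarith
    · nlinarith

theorem swap_mem_of_middle {A B x y z : ℝ} (hA0 : 0 < A) (hA1 : A ≤ 1) (hB0 : 0 < B) (hB1 : B ≤ 1)
    (hAB : A = 1 ∨ B = 1) (hzx : B * z ≤ A * x) (hxy : A * x ≤ B * y)
    {s a b : ℝ} (hS : s + a + b = x + y + z)
    (hs : s ∈ Set.Icc (x - (A * x - B * z)) (x - (A * x - B * y)))
    (ha : a ∈ Set.Icc z y) (hb : b ∈ Set.Icc z y) :
    s - (A * s - B * a) ∈ Set.Icc (x - (A * x - B * z)) (x - (A * x - B * y)) ∧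
      a + (A * s - B * a) ∈ Set.Icc z y := by
  rcases hAB with rfl | rfl
  · have k1 := mul_nonneg (sub_nonneg.2 hB1) (sub_nonneg.2 hzx)
    have k2 := mul_nonneg (sub_nonneg.2 hB1) (sub_nonneg.2 hxy)
    refine swap_mem_of_degenerate_larger hB0.le hB1 ?_ ?_ ?_ ?_ hS hs ha hb
    · nlinarith
    · nlinarith
    · nlinarith
    · nlinarith
  · have k1 := mul_nonneg (sub_nonneg.2 hA1) (sub_nonneg.2 hzx)
    have k2 := mul_nonneg (sub_nonneg.2 hA1) (sub_nonneg.2 hxy)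
    refine swap_mem_of_degenerate_smaller hA0.le hA1 ?_ ?_ ?_ ?_ hS hs ha hb
    · nlinarith
    · nlinarith
    · nlinarith
    · nlinarith

theorem Reach.mem_levelRegion {d : Fin 3 → ℝ} (hpos : ∀ i, 0 < d i) {s a b : Fin 3} (hsa : s ≠ a)
    (hsb : s ≠ b) (hab : a ≠ b) (hd : d a = d b) {A B S uL uH m M : ℝ}
    (ha : ∀ v, pairFlow d s a v = A * v s - B * v a)
    (hb : ∀ v, pairFlow d s b v = A * v s - B * v b)
    (key : ∀ x y z : ℝ, x + y + z = S → x ∈ Set.Icc uL uH → y ∈ Set.Icc m M → z ∈ Set.Icc m M →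
      x - (A * x - B * y) ∈ Set.Icc uL uH ∧ y + (A * x - B * y) ∈ Set.Icc m M)
    {p q : Fin 3 → ℝ} (hp : p ∈ levelRegion s a b S uL uH m M) (h : Reach d p q) :
    q ∈ levelRegion s a b S uL uH m M := by
  have flow_ab : ∀ v, pairFlow d a b v = v a - v b := by
    intro v
    have := (hpos b).ne'
    rw [pairFlow, hd, min_self]
    field_simp
  have cover : ∀ k, k = s ∨ k = a ∨ k = b := by
    revert hsa hsb hab
    clear * -
    decide +revert
  refine h.mem_of_convex hpos (convex_levelRegion s a b S uL uH m M) ?_ hp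
  rintro v ⟨h1, h2, h3, h4⟩ i j w hij hi hj hk
  have ka := key (v s) (v a) (v b) h1 h2 h3 h4
  have kb := key (v s) (v b) (v a) (by linarith) h2 h4 h3
  rw [← ha] at ka
  rw [← hb] at kb
  have flow_as := pairFlow_swap d s a v
  have flow_bs := pairFlow_swap d s b v
  have flow_ba := pairFlow_swap d a b v
  have hab' := flow_ab v
  have e : ∀ x y z : ℝ, w s = x → w a = y → w b = z → x + y + z = S → x ∈ Set.Icc uL uH →
      y ∈ Set.Icc m M → z ∈ Set.Icc m M → w ∈ levelRegion s a b S uL uH m M := by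
    rintro x y z rfl rfl rfl e1 e2 e3 e4
    exact ⟨e1, e2, e3, e4⟩
  rcases cover i with rfl | rfl | rfl <;> rcases cover j with rfl | rfl | rfl <;>
    first
    | exact absurd rfl hij
    | skip
  · exact e _ _ _ hi hj (hk _ hsb.symm hab.symm) (by linarith) ka.1 ka.2 h4
  · exact e _ _ _ hi (hk _ hsa.symm hab) hj (by linarith) kb.1 h3 kb.2
  · rw [flow_as] at hi hj
    exact e (v j - pairFlow d j i v) (v i + pairFlow d j i v) _ (hj.trans (by ring))
      (hi.trans (by ring))
      (hk _ hab.symm hsb.symm) (by linarith) ka.1 ka.2 h4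
  · exact e _ (v j) (v i) (hk _ hsa hsb) (by linarith) (by linarith) (by linarith) h2 h4 h3
  · rw [flow_bs] at hi hj
    exact e (v j - pairFlow d j i v) _ (v i + pairFlow d j i v) (hj.trans (by ring))
      (hk _ hab hsa.symm)
      (hi.trans (by ring)) (by linarith) kb.1 h3 kb.2
  · exact e _ (v i) (v j) (hk _ hsb hsa) (by linarith) (by linarith) (by linarith) h2 h4 h3

theorem exists_pairFlow_coeff {d : Fin 3 → ℝ} (hpos : ∀ i, 0 < d i) {s a b : Fin 3}
    (hd : d a = d b) :
    ∃ A B : ℝ, 0 < A ∧ A ≤ 1 ∧ 0 < B ∧ B ≤ 1 ∧ (A = 1 ∨ B = 1) ∧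
      (∀ v, pairFlow d s a v = A * v s - B * v a) ∧
      ∀ v, pairFlow d s b v = A * v s - B * v b := by
  have hm : 0 < min (d s) (d a) := lt_min (hpos s) (hpos a)
  refine ⟨min (d s) (d a) / d s, min (d s) (d a) / d a, div_pos hm (hpos s),
    (div_le_one (hpos s)).2 (min_le_left _ _), div_pos hm (hpos a),
    (div_le_one (hpos a)).2 (min_le_right _ _), ?_, fun v => ?_, fun v => ?_⟩
  · rcases le_total (d s) (d a) with h | h
    · left; rw [min_eq_left h, div_self (hpos s).ne']
    · right; rw [min_eq_right h, div_self (hpos a).ne']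
  · rw [pairFlow]; ring
  · rw [pairFlow, ← hd]; ring

/-- Equal levels `a`, `b` can be mixed: every vector with the same total on `a`, `b` and entries
between the ones of `v` is reachable. -/
theorem reach_of_mix {d : Fin 3 → ℝ} (hpos : ∀ i, 0 < d i) {s a b : Fin 3} (hsa : s ≠ a)
    (hsb : s ≠ b) (hab : a ≠ b) (hd : d a = d b) {v q : Fin 3 → ℝ} (hs : q s = v s)
    (hsum : q a + q b = v a + v b) (hqa : q a ∈ Set.Icc (v b) (v a)) : Reach d v q := by
  have flow_ab : pairFlow d a b v = v a - v b := by
    have := (hpos b).ne'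
    rw [pairFlow, hd, min_self]
    field_simp
  have cover : ∀ k, k = s ∨ k = a ∨ k = b := by
    revert hsa hsb hab
    clear * -
    decide +revert
  obtain ⟨w, hw, h1, h2, h3⟩ := exists_reach_of_flow hpos hab v (z := v a - q a) (by
    rw [flow_ab, Set.uIcc_of_le (by linarith [hqa.1, hqa.2])]
    exact ⟨by linarith [hqa.2], by linarith [hqa.1]⟩)
  convert hw using 1
  ext k
  rcases cover k with rfl | rfl | rfl
  · rw [hs, h3 _ hsa hsb]
  · linarith
  · linarith

theorem convex_setOf_reach_of_top {d : Fin 3 → ℝ} (hpos : ∀ i, 0 < d i) {s a b : Fin 3}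
    (hsa : s ≠ a) (hsb : s ≠ b) (hab : a ≠ b) (hd : d a = d b) {p : Fin 3 → ℝ} (hba : p b ≤ p a)
    (has : 0 ≤ pairFlow d s a p) : Convex ℝ {q | Reach d p q} := by
  obtain ⟨A, B, hA0, hA1, hB0, hB1, hAB, ha, hb⟩ := exists_pairFlow_coeff (s := s) hpos hd
  obtain ⟨x', hx'⟩ : ∃ x', x' = p s - (A * p s - B * p a) := ⟨_, rfl⟩
  obtain ⟨M, hM⟩ : ∃ M, M = p a + (A * p s - B * p a) := ⟨_, rfl⟩
  obtain ⟨uL, huL⟩ : ∃ uL, uL = x' - (A * x' - B * p b) := ⟨_, rfl⟩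
  have hyx : B * p a ≤ A * p s := by linarith [ha p]
  -- After the full swap with `a`, level `s` is still at least as hot as `b`; hence `uL ≤ x'`.
  have hx'z : B * p b ≤ A * x' := by
    have h1 := mul_nonneg hB0.le (sub_nonneg.2 hba)
    rcases hAB with rfl | rfl
    · nlinarith
    · have := mul_nonneg (sub_nonneg.2 hA1) (sub_nonneg.2 hyx)
      nlinarith
  have hR : {q | Reach d p q} = levelRegion s a b (p s + p a + p b) uL (p s) (p b) M := by
    ext q
    constructor
    · refine Reach.mem_levelRegion hpos hsa hsb hab hd ha hb ?_ ?_
      · intro x y z hS hx hy hz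
        exact swap_mem_of_top hA0 hA1 hB0 hB1 hAB hba hyx hx' hM huL hS hx hy hz
      · refine ⟨rfl, ⟨?_, le_rfl⟩, ⟨hba, ?_⟩, ⟨le_rfl, ?_⟩⟩ <;> linarith
    · rintro ⟨hS, ⟨q1, q2⟩, ⟨q3, q4⟩, ⟨q5, q6⟩⟩
      -- Down to `x'`, a partial swap with `a` suffices to set the entry at `s`; below it, the full
      -- swap with `a` is followed by a partial one with `b`.
      rcases le_total x' (q s) with h | h
      · obtain ⟨w, hw, w1, w2, w3⟩ := exists_reach_of_flow hpos hsa p (z := p s - q s) (by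
          rw [ha, Set.uIcc_of_le (by linarith)]
          exact ⟨by linarith, by linarith⟩)
        have w4 := w3 b hsb.symm hab.symm
        exact hw.trans (reach_of_mix hpos hsa hsb hab hd (by linarith) (by linarith)
          ⟨by linarith, by linarith⟩)
      · obtain ⟨w, hw, w1, w2, w3⟩ := exists_reach_of_flow hpos hsa p (z := A * p s - B * p a) (by
          rw [ha]; exact Set.right_mem_uIcc)
        have w4 := w3 b hsb.symm hab.symm
        have hws : w s = x' := by linarith
        obtain ⟨u, hu, u1, u2, u3⟩ := exists_reach_of_flow hpos hsb w (z := x' - q s) (by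
          rw [hb, hws, w4, Set.uIcc_of_le (by linarith)]
          exact ⟨by linarith, by linarith⟩)
        have u4 := u3 a hsa.symm hab
        exact hw.trans (hu.trans (reach_of_mix hpos hsa hsb hab hd (by linarith) (by linarith)
          ⟨by linarith, by linarith⟩))
  rw [hR]
  exact convex_levelRegion ..

theorem convex_setOf_reach_of_middle {d : Fin 3 → ℝ} (hpos : ∀ i, 0 < d i) {s a b : Fin 3}
    (hsa : s ≠ a) (hsb : s ≠ b) (hab : a ≠ b) (hd : d a = d b) {p : Fin 3 → ℝ}
    (has : pairFlow d s a p ≤ 0) (hbs : 0 ≤ pairFlow d s b p) : Convex ℝ {q | Reach d p q} := by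
  obtain ⟨A, B, hA0, hA1, hB0, hB1, hAB, ha, hb⟩ := exists_pairFlow_coeff (s := s) hpos hd
  rw [ha] at has
  rw [hb] at hbs
  have hba : p b ≤ p a := le_of_mul_le_mul_left (by linarith) hB0
  have hR : {q | Reach d p q} = levelRegion s a b (p s + p a + p b)
      (p s - (A * p s - B * p b)) (p s - (A * p s - B * p a)) (p b) (p a) := by
    ext q
    constructor
    · refine Reach.mem_levelRegion hpos hsa hsb hab hd ha hb ?_ ?_
      · intro x y z hS hx hy hz
        exact swap_mem_of_middle hA0 hA1 hB0 hB1 hAB (by linarith) (by linarith) hS hx hy hz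
      · refine ⟨rfl, ⟨?_, ?_⟩, ⟨hba, le_rfl⟩, ⟨le_rfl, hba⟩⟩ <;> linarith
    · rintro ⟨hS, ⟨q1, q2⟩, ⟨q3, q4⟩, ⟨q5, q6⟩⟩
      rcases le_total (p s) (q s) with h | h
      · obtain ⟨w, hw, w1, w2, w3⟩ := exists_reach_of_flow hpos hsa p (z := p s - q s) (by
          rw [ha, Set.uIcc_of_ge (by linarith)]
          exact ⟨by linarith, by linarith⟩)
        have w4 := w3 b hsb.symm hab.symm
        exact hw.trans (reach_of_mix hpos hsa hsb hab hd (by linarith) (by linarith)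
          ⟨by linarith, by linarith⟩)
      · obtain ⟨w, hw, w1, w2, w3⟩ := exists_reach_of_flow hpos hsb p (z := p s - q s) (by
          rw [hb, Set.uIcc_of_le (by linarith)]
          exact ⟨by linarith, by linarith⟩)
        have w4 := w3 a hsa.symm hab
        exact hw.trans (reach_of_mix hpos hsa hsb hab hd (by linarith) (by linarith)
          ⟨by linarith, by linarith⟩)
  rw [hR]
  exact convex_levelRegion ..

theorem convex_setOf_reach_neg {n : ℕ} {d p : Fin n → ℝ} (h : Convex ℝ {q | Reach d (-p) q}) :
    Convex ℝ {q | Reach d p q} := by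
  have e : {q | Reach d p q} = -{q | Reach d (-p) q} := by
    ext q
    refine ⟨fun hq => Reach.neg hq, fun hq => ?_⟩
    have hq' : Reach d (-p) (-q) := hq
    simpa using hq'.neg
  rw [e]
  exact h.neg

theorem pairFlow_neg {n : ℕ} (d : Fin n → ℝ) (i j : Fin n) (v : Fin n → ℝ) :
    pairFlow d i j (-v) = -pairFlow d i j v := by
  simp only [pairFlow, Pi.neg_apply]
  ring

/-- The signs of the two flows out of `s` say whether it is hottest, in between or coldest; negating
`p` turns the coldest case into the hottest. -/
theorem convex_setOf_reach_of_degenerate {d : Fin 3 → ℝ} (hpos : ∀ i, 0 < d i) {s a b : Fin 3}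
    (hsa : s ≠ a) (hsb : s ≠ b) (hab : a ≠ b) (hd : d a = d b) (p : Fin 3 → ℝ) :
    Convex ℝ {q | Reach d p q} := by
  have top : ∀ p, 0 ≤ pairFlow d s a p → 0 ≤ pairFlow d s b p → Convex ℝ {q | Reach d p q} := by
    intro p h1 h2
    rcases le_total (p b) (p a) with h | h
    · exact convex_setOf_reach_of_top hpos hsa hsb hab hd h h1
    · exact convex_setOf_reach_of_top hpos hsb hsa hab.symm hd.symm h h2
  rcases le_total 0 (pairFlow d s a p) with h1 | h1 <;>
    rcases le_total 0 (pairFlow d s b p) with h2 | h2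
  · exact top p h1 h2
  · exact convex_setOf_reach_of_middle hpos hsb hsa hab.symm hd.symm h2 h1
  · exact convex_setOf_reach_of_middle hpos hsa hsb hab hd h1 h2
  · refine convex_setOf_reach_neg (top _ ?_ ?_) <;> rw [pairFlow_neg] <;> linarith

theorem IsQuasiUniform.convex_wetoReachable {d : Fin 3 → ℝ} (hpos : ∀ i, 0 < d i)
    (h : IsQuasiUniform d) {p : Fin 3 → ℝ} (hp : p ∈ stdSimplex ℝ (Fin 3)) :
    Convex ℝ (wetoReachable d p) := by
  rw [wetoReachable_eq_setOf_reach hpos hp]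
  have h3 : d 1 = d 2 ∨ d 0 = d 2 ∨ d 0 = d 1 := by
    obtain ⟨x, y, hxy⟩ := h
    rcases hxy 0 with h0 | h0 <;> rcases hxy 1 with h1 | h1 <;> rcases hxy 2 with h2 | h2 <;>
      simp [h0, h1, h2]
  rcases h3 with h | h | h
  · exact convex_setOf_reach_of_degenerate hpos (s := 0) (by decide) (by decide) (by decide) h p
  · exact convex_setOf_reach_of_degenerate hpos (s := 1) (by decide) (by decide) (by decide) h p
  · exact convex_setOf_reach_of_degenerate hpos (s := 2) (by decide) (by decide) (by decide) h p

/-! ### Three different weights: an edge that cannot be traversed. -/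

/-- The linear functional supporting the edge of the reachable set that cannot be traversed. -/
def edgeFunctional (α β y z : ℝ) : ℝ :=
  (1 - α * β) * y + (α - α * β) * z

/-- A region invariant under the two-level steps of three levels of weights `1`, `α`, `α * β`. On
the face where `edgeFunctional` is maximal, it contains the end points of the edge only. -/
structure EdgeRegion (α β s x y z : ℝ) : Prop where
  sum : x + y + z = 1 + α * β * s
  x_le : x ≤ 1
  le_x : (1 - α) * (1 - α * β * (1 - s)) ≤ x
  y_nonneg : 0 ≤ y
  y_le : y ≤ α
  z_nonneg : 0 ≤ z
  z_le : z ≤ α * β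
  functional_le : edgeFunctional α β y z ≤ edgeFunctional α β α (α * β * s)
  endpoint : edgeFunctional α β y z = edgeFunctional α β α (α * β * s) →
    y = α ∨ y = α * (1 - (1 - β) * (α * β * (1 - s)))

namespace EdgeRegion

variable {α β s x y z t : ℝ}

theorem start (hα0 : 0 < α) (hα1 : α < 1) (hβ0 : 0 < β) (hβ1 : β < 1) (hs0 : 0 < s) (hs1 : s < 1) :
    EdgeRegion α β s 1 0 (α * β * s) := by
  have h1 : 0 < α * β := mul_pos hα0 hβ0
  have h2 : α * β < 1 := by nlinarith
  have h3 : 0 < (1 - α * β) * α := mul_pos (by linarith) hα0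
  have h4 : 0 < α * β * (1 - s) := mul_pos h1 (by linarith)
  refine ⟨by ring, le_rfl, ?_, le_rfl, hα0.le, by positivity, by nlinarith, ?_, ?_⟩
  · nlinarith
  · simp only [edgeFunctional]; linarith
  · simp only [edgeFunctional]; intro h; linarith

/-- Steps towards a vector of the closed region whose functional is not maximal unless it is an
end point of the edge that is the image of a vector with smaller functional. -/
theorem edge_step {c g g' y y' y₁ y₂ : ℝ} (hg : g ≤ c) (hg' : g' ≤ c) (h0 : 0 ≤ t) (h1 : t ≤ 1)
    (hy : g = c → y = y₁ ∨ y = y₂)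
    (himg : g' = c → g < c ∧ (y' = y₁ ∨ y' = y₂)) (h : (1 - t) * g + t * g' = c) :
    (1 - t) * y + t * y' = y₁ ∨ (1 - t) * y + t * y' = y₂ := by
  rcases h0.eq_or_lt with rfl | ht0
  · simpa using hy (by simpa using h)
  -- A mixture with `t > 0` is maximal only if the image is; the source is then strictly below,
  -- which forces `t = 1`.
  have e' : g' = c := by
    by_contra hne
    have : g' < c := lt_of_le_of_ne hg' hne
    nlinarith [mul_nonneg (sub_nonneg.2 h1) (sub_nonneg.2 hg)]
  obtain ⟨hlt, hy'⟩ := himg e'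
  have ht1 : t = 1 := by
    by_contra hne
    have : t < 1 := lt_of_le_of_ne h1 hne
    nlinarith [mul_pos (sub_pos.2 this) (sub_pos.2 hlt)]
  subst ht1
  simpa using hy'

/-- Mixing a vector of the region with one that satisfies the closed inequalities. -/
theorem mix (h : EdgeRegion α β s x y z) {x' y' z' : ℝ} (h0 : 0 ≤ t) (h1 : t ≤ 1)
    (hsum : x' + y' + z' = 1 + α * β * s) (hx1 : x' ≤ 1)
    (hx0 : (1 - α) * (1 - α * β * (1 - s)) ≤ x') (hy0 : 0 ≤ y') (hy1 : y' ≤ α) (hz0 : 0 ≤ z')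
    (hz1 : z' ≤ α * β)
    (hg : edgeFunctional α β y' z' ≤ edgeFunctional α β α (α * β * s))
    (himg : edgeFunctional α β y' z' = edgeFunctional α β α (α * β * s) →
      edgeFunctional α β y z < edgeFunctional α β α (α * β * s) ∧
        (y' = α ∨ y' = α * (1 - (1 - β) * (α * β * (1 - s))))) :
    EdgeRegion α β s ((1 - t) * x + t * x') ((1 - t) * y + t * y') ((1 - t) * z + t * z') := by
  have ht : 0 ≤ 1 - t := by linarith
  have hlin : edgeFunctional α β ((1 - t) * y + t * y') ((1 - t) * z + t * z') =
      (1 - t) * edgeFunctional α β y z + t * edgeFunctional α β y' z' := by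
    simp only [edgeFunctional]; ring
  have upper : ∀ {a b u : ℝ}, a ≤ u → b ≤ u → (1 - t) * a + t * b ≤ u := fun ha hb => by
    linarith [mul_nonneg ht (sub_nonneg.2 ha), mul_nonneg h0 (sub_nonneg.2 hb)]
  have lower : ∀ {a b u : ℝ}, u ≤ a → u ≤ b → u ≤ (1 - t) * a + t * b := fun ha hb => by
    linarith [mul_nonneg ht (sub_nonneg.2 ha), mul_nonneg h0 (sub_nonneg.2 hb)]
  refine ⟨?_, upper h.x_le hx1, lower h.le_x hx0, lower h.y_nonneg hy0, upper h.y_le hy1,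
    lower h.z_nonneg hz0, upper h.z_le hz1, ?_, ?_⟩
  · linear_combination (1 - t) * h.sum + t * hsum
  · rw [hlin]; exact upper h.functional_le hg
  · rw [hlin]; exact edge_step h.functional_le hg h0 h1 h.endpoint himg

/-- The image's functional is the maximum minus positive multiples of `1 - x` and `y`; equality
leaves only the starting vector, which is sent to the endpoint `y = α`. -/
theorem step_xy (h : EdgeRegion α β s x y z) (hα0 : 0 < α) (hα1 : α < 1) (hβ0 : 0 < β)
    (hβ1 : β < 1) (hs0 : 0 < s) (h0 : 0 ≤ t) (h1 : t ≤ 1) :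
    EdgeRegion α β s ((1 - t) * x + t * ((1 - α) * x + y)) ((1 - t) * y + t * (α * x))
      ((1 - t) * z + t * z) := by
  have hαβ : 0 < α * β := mul_pos hα0 hβ0
  have hαβ1 : α * β < 1 := by nlinarith
  have hα1' : 0 < 1 - α := by linarith
  have hβ1' : 0 < 1 - β := by linarith
  have k1 := mul_nonneg hα1'.le (sub_nonneg.2 h.x_le)
  have k2 := mul_nonneg hα0.le h.y_nonneg
  have k3 := mul_nonneg hα0.le (sub_nonneg.2 h.x_le)
  have k4 := mul_nonneg hα1'.le (sub_nonneg.2 h.z_le)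
  have hsum := h.sum
  have hy := h.y_nonneg
  have hx := h.x_le
  have hmu : 0 ≤ (1 - α) * (1 - α * β * (1 - s)) := mul_nonneg hα1'.le (by nlinarith)
  have c1 : 0 < α * (1 - β) := mul_pos hα0 hβ1'
  have c2 : 0 < α * β * (1 - α) := mul_pos hαβ hα1'
  have e : edgeFunctional α β (α * x) z = edgeFunctional α β α (α * β * s) -
      (α * β * (1 - α)) * (1 - x) - α * (1 - β) * y := by
    simp only [edgeFunctional]
    linear_combination (α - α * β) * hsum
  have p1 := mul_nonneg c2.le (sub_nonneg.2 hx)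
  have p2 := mul_nonneg c1.le hy
  refine h.mix h0 h1 (by linear_combination hsum) ?_ ?_ ?_ ?_ h.z_nonneg h.z_le ?_ ?_
  · linarith [h.y_le]
  · nlinarith
  · exact mul_nonneg hα0.le (hmu.trans h.le_x)
  · linarith
  · rw [e]; linarith
  · rw [e]
    intro hc
    have hx1 : x = 1 := by
      by_contra hne
      have := mul_pos c2 (sub_pos.2 (lt_of_le_of_ne hx hne))
      linarith
    have hy0 : y = 0 := by
      by_contra hne
      have := mul_pos c1 (lt_of_le_of_ne hy (Ne.symm hne))
      linarith
    subst hx1 hy0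
    refine ⟨?_, Or.inl (mul_one α)⟩
    have hz : z = α * β * s := by linarith
    subst hz
    simp only [edgeFunctional]
    have := mul_pos (sub_pos.2 hαβ1) hα0
    linarith

theorem step_xz (h : EdgeRegion α β s x y z) (hα0 : 0 < α) (hα1 : α < 1) (hβ0 : 0 < β)
    (hβ1 : β < 1) (hs0 : 0 < s) (hs : s * (1 - α * β) = 1 - α) (h0 : 0 ≤ t)
    (h1 : t ≤ 1) :
    EdgeRegion α β s ((1 - t) * x + t * ((1 - α * β) * x + z)) ((1 - t) * y + t * y)
      ((1 - t) * z + t * (α * β * x)) := by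
  have hαβ : 0 < α * β := mul_pos hα0 hβ0
  have hαβ1 : α * β < 1 := by nlinarith
  have hα1' : 0 < 1 - α := by linarith
  have hβ1' : 0 < 1 - β := by linarith
  have hsum := h.sum
  have hz := h.z_nonneg
  have hy := h.y_le
  have hx := h.x_le
  have hmu : 0 ≤ (1 - α) * (1 - α * β * (1 - s)) := mul_nonneg hα1'.le (by nlinarith)
  have c1 : 0 < (α - α * β) * (α * β) := mul_pos (by nlinarith) hαβ
  have c2 : 0 < (1 - α * β) - (α - α * β) * (α * β) := by nlinarith
  -- The choice `hs` of `s` enters here: it makes this swap send the vertex `y = α`, `z = 0` exactly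
  -- to the endpoint `y = α`, `z = α * β * s`, not beyond the edge.
  have e : edgeFunctional α β y (α * β * x) = edgeFunctional α β α (α * β * s) -
      ((1 - α * β) - (α - α * β) * (α * β)) * (α - y) - (α - α * β) * (α * β) * z := by
    simp only [edgeFunctional]
    linear_combination (α - α * β) * (α * β) * hsum - (α - α * β) * (α * β) * hs
  have p1 := mul_nonneg c2.le (sub_nonneg.2 hy)
  have p2 := mul_nonneg c1.le hz
  refine h.mix h0 h1 (by linear_combination hsum) ?_ ?_ h.y_nonneg hy ?_ ?_ ?_ ?_
  · nlinarith [h.z_le]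
  -- By `hs` the new first entry equals `(1 - α * β) * (s + α - y) + α * β * z`, which is at least
  -- `1 - α`; the quantity in `k3` is the slack `(1 - α) * (α * β * (1 - s))`.
  · have k1 := mul_nonneg (sub_nonneg.2 hαβ1.le) (sub_nonneg.2 hy)
    have k2 := mul_nonneg hαβ.le hz
    have k3 := mul_pos (mul_pos hα0 (mul_pos hαβ hs0)) hβ1'
    nlinarith
  · exact mul_nonneg hαβ.le (hmu.trans h.le_x)
  · nlinarith
  · rw [e]; linarith
  · rw [e]
    intro hc
    have hy1 : y = α := by
      by_contra hne
      have := mul_pos c2 (sub_pos.2 (lt_of_le_of_ne hy hne))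
      linarith
    have hz0 : z = 0 := by
      by_contra hne
      have := mul_pos c1 (lt_of_le_of_ne hz (Ne.symm hne))
      linarith
    subst hy1 hz0
    refine ⟨?_, Or.inl rfl⟩
    simp only [edgeFunctional]
    have := mul_pos c1 hs0
    nlinarith

/-- Here equality forces the least `x` and the greatest `z`, and this vector is sent to the second
endpoint. -/
theorem step_yz (h : EdgeRegion α β s x y z) (hα0 : 0 < α) (hα1 : α < 1) (hβ0 : 0 < β)
    (hβ1 : β < 1) (hs1 : s < 1) (h0 : 0 ≤ t) (h1 : t ≤ 1) :
    EdgeRegion α β s ((1 - t) * x + t * x) ((1 - t) * y + t * ((1 - β) * y + z))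
      ((1 - t) * z + t * (β * y)) := by
  have hαβ : 0 < α * β := mul_pos hα0 hβ0
  have hαβ1 : α * β < 1 := by nlinarith
  have hα1' : 0 < 1 - α := by linarith
  have hβ1' : 0 < 1 - β := by linarith
  have hsum := h.sum
  have hz := h.z_le
  have hx := h.le_x
  have c2 : 0 < β * (1 - α) := mul_pos hβ0 hα1'
  have e : edgeFunctional α β ((1 - β) * y + z) (β * y) = edgeFunctional α β α (α * β * s) -
      (1 - β) * (x - (1 - α) * (1 - α * β * (1 - s))) - β * (1 - α) * (α * β - z) := by
    simp only [edgeFunctional]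
    linear_combination (1 - β) * hsum
  have p1 := mul_nonneg hβ1'.le (sub_nonneg.2 hx)
  have p2 := mul_nonneg c2.le (sub_nonneg.2 hz)
  have k1 := mul_nonneg hβ1'.le h.y_nonneg
  have k2 := mul_nonneg hβ1'.le (sub_nonneg.2 h.y_le)
  have k3 := mul_nonneg hβ0.le (sub_nonneg.2 h.y_le)
  refine h.mix h0 h1 (by linear_combination hsum) h.x_le hx ?_ ?_ ?_ ?_ ?_ ?_
  · linarith [h.z_nonneg]
  · linarith
  · exact mul_nonneg hβ0.le h.y_nonneg
  · linarith
  · rw [e]; linarith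
  · rw [e]
    intro hc
    have hx1 : x = (1 - α) * (1 - α * β * (1 - s)) := by
      by_contra hne
      have := mul_pos hβ1' (sub_pos.2 (lt_of_le_of_ne hx (Ne.symm hne)))
      linarith
    have hz0 : z = α * β := by
      by_contra hne
      have := mul_pos c2 (sub_pos.2 (lt_of_le_of_ne hz hne))
      linarith
    have hy0 : y = α * (1 - α * β * (1 - s)) := by
      subst hx1 hz0
      linear_combination hsum
    subst hy0 hz0
    refine ⟨?_, Or.inr (by ring)⟩
    simp only [edgeFunctional]
    have := mul_pos (mul_pos (mul_pos hα0 hαβ) (sub_pos.2 hs1)) c2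
    nlinarith

end EdgeRegion

/-! ### Monotonicity of the occupied weight. -/

/-- The total weight of the occupied levels. -/
noncomputable def supportWeight {n : ℕ} (d q : Fin n → ℝ) : ℝ :=
  ∑ k, if 0 < q k then d k else 0

theorem supportWeight_comp_swap {n : ℕ} {d : Fin n → ℝ} {i j : Fin n} (h : d i = d j)
    (q : Fin n → ℝ) : supportWeight d (q ∘ Equiv.swap i j) = supportWeight d q := by
  have hd : ∀ k, d (Equiv.swap i j k) = d k := by
    intro k
    rw [Equiv.swap_apply_def]
    split_ifs with h1 h2
    · rw [h1, h]
    · rw [h2, h]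
    · rfl
  unfold supportWeight
  rw [← Equiv.sum_comp (Equiv.swap i j) (fun k => if 0 < q k then d k else 0)]
  exact Finset.sum_congr rfl fun k _ => by simp [hd]

theorem supportWeight_sub_of_eq_off_pair {n : ℕ} (d : Fin n → ℝ) {i j : Fin n} (hij : i ≠ j)
    {q w : Fin n → ℝ} (h : ∀ k, k ≠ i → k ≠ j → w k = q k) :
    supportWeight d w - supportWeight d q =
      ((if 0 < w i then d i else 0) - (if 0 < q i then d i else 0)) +
        ((if 0 < w j then d j else 0) - (if 0 < q j then d j else 0)) := by
  unfold supportWeight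
  rw [← Finset.sum_sub_distrib, ← Finset.sum_pair
    (f := fun k => (if 0 < w k then d k else 0) - if 0 < q k then d k else 0) hij]
  symm
  refine Finset.sum_subset (Finset.subset_univ _) ?_
  intro k _ hk
  simp only [Finset.mem_insert, Finset.mem_singleton, not_or] at hk
  rw [h k hk.1 hk.2, sub_self]

/-- If one level of the pair is empty, a nontrivial step either occupies both or carries everything
across. The latter happens only towards a weight at least as large, so without gain only between
equal weights. -/
theorem levelStep_eq_or_supportWeight_lt {n : ℕ} {d : Fin n → ℝ} (hpos : ∀ i, 0 < d i)
    {i j : Fin n} (hij : i ≠ j) {t : ℝ} (hd : d j ≤ d i) (h0 : 0 ≤ t) (h1 : t ≤ 1)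
    {q : Fin n → ℝ} (hq : ∀ k, 0 ≤ q k) (hz : q i = 0 ∨ q j = 0) :
    levelStep d i j t q = q ∨ (d i = d j ∧ levelStep d i j t q = q ∘ Equiv.swap i j) ∨
      supportWeight d q < supportWeight d (levelStep d i j t q) := by
  have hγ0 : 0 < d j / d i := div_pos (hpos j) (hpos i)
  have hγ1 : d j / d i ≤ 1 := (div_le_one (hpos i)).2 hd
  obtain ⟨w, hw⟩ : ∃ w, w = levelStep d i j t q := ⟨_, rfl⟩
  have wi : w i = q i + t * (q j - d j / d i * q i) := by rw [hw, levelStep_apply_left d hij]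
  have wj : w j = q j - t * (q j - d j / d i * q i) := by rw [hw, levelStep_apply_right d hij]
  have wk : ∀ k, k ≠ i → k ≠ j → w k = q k := fun k hi hj => by
    rw [hw, levelStep_apply_of_ne d hi hj]
  have hwt := supportWeight_sub_of_eq_off_pair d hij wk
  rw [← hw]
  have same : w i = q i → w j = q j → w = q := by
    intro e1 e2
    ext k
    by_cases hi : k = i
    · rw [hi, e1]
    by_cases hj : k = j
    · rw [hj, e2]
    exact wk k hi hj
  have swapped : w i = q j → w j = q i → w = q ∘ Equiv.swap i j := by
    intro e1 e2
    ext k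
    by_cases hi : k = i
    · rw [hi, e1]; simp
    by_cases hj : k = j
    · rw [hj, e2]; simp
    rw [wk k hi hj, Function.comp_apply, Equiv.swap_apply_of_ne_of_ne hi hj]
  rcases h0.eq_or_lt with rfl | ht
  · left
    exact same (by rw [wi]; ring) (by rw [wj]; ring)
  have hdi := hpos i
  have hdj := hpos j
  rcases (hq i).eq_or_lt with qi | qi
  · rcases (hq j).eq_or_lt with qj | qj
    · left
      exact same (by rw [wi, ← qi, ← qj]; ring) (by rw [wj, ← qi, ← qj]; ring)
    right
    have wi' : 0 < w i := by rw [wi, ← qi]; nlinarith [mul_pos ht qj]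
    rcases h1.eq_or_lt with rfl | ht1
    · have wj' : w j = 0 := by rw [wj, ← qi]; ring
      rcases hd.eq_or_lt with e | e
      · exact Or.inl ⟨e.symm, swapped (by rw [wi, ← qi]; ring) (by rw [wj', ← qi])⟩
      · right
        rw [if_pos wi', if_neg (by rw [← qi]; exact lt_irrefl _),
          if_neg (by rw [wj']; exact lt_irrefl _), if_pos qj] at hwt
        linarith
    · right
      have wj' : 0 < w j := by rw [wj, ← qi]; nlinarith [mul_pos (sub_pos.2 ht1) qj]
      rw [if_pos wi', if_neg (by rw [← qi]; exact lt_irrefl _), if_pos wj', if_pos qj] at hwt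
      linarith
  · have qj : q j = 0 := hz.resolve_left qi.ne'
    right
    have wj' : 0 < w j := by
      rw [wj, qj]
      nlinarith [mul_pos (mul_pos ht hγ0) qi]
    have tγ : t * (d j / d i) ≤ 1 := mul_le_one₀ h1 hγ0.le hγ1
    rcases tγ.eq_or_lt with e | e
    · left
      have ht1 : t = 1 := by nlinarith
      subst ht1
      have e' : d j = d i := by
        rw [one_mul, div_eq_one_iff_eq hdi.ne'] at e
        exact e
      have e2 : d j / d i = 1 := by rwa [one_mul] at e
      exact ⟨e'.symm, swapped (by rw [wi, qj, e2]; ring) (by rw [wj, qj, e2]; ring)⟩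
    · right
      have wi' : 0 < w i := by
        rw [wi, qj]
        nlinarith [mul_pos (sub_pos.2 e) qi]
      rw [if_pos wi', if_pos qi, if_pos wj', if_neg (by rw [qj]; exact lt_irrefl _)] at hwt
      linarith

theorem supportWeight_le_levelStep {n : ℕ} {d : Fin n → ℝ} (hpos : ∀ i, 0 < d i) {i j : Fin n}
    {t : ℝ} (hd : d j ≤ d i) (h0 : 0 ≤ t) (h1 : t ≤ 1) {q : Fin n → ℝ} (hq : ∀ k, 0 ≤ q k) :
    supportWeight d q ≤ supportWeight d (levelStep d i j t q) := by
  rcases eq_or_ne i j with rfl | hij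
  · rw [levelStep_self]
  by_cases hz : q i = 0 ∨ q j = 0
  · rcases levelStep_eq_or_supportWeight_lt hpos hij hd h0 h1 hq hz with h | ⟨e, h⟩ | h
    · rw [h]
    · rw [h, supportWeight_comp_swap e]
    · exact h.le
  · push Not at hz
    have qi : 0 < q i := lt_of_le_of_ne (hq i) (Ne.symm hz.1)
    have qj : 0 < q j := lt_of_le_of_ne (hq j) (Ne.symm hz.2)
    have hγ0 : 0 < d j / d i := div_pos (hpos j) (hpos i)
    have hγ1 : d j / d i ≤ 1 := (div_le_one (hpos i)).2 hd
    have hwt := supportWeight_sub_of_eq_off_pair d hij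
      (fun k hi hj => levelStep_apply_of_ne d hi hj t q)
    have wi : 0 < levelStep d i j t q i := by
      rw [levelStep_apply_left d hij]
      rcases h0.eq_or_lt with rfl | ht
      · linarith
      · have : t * (d j / d i) ≤ 1 := mul_le_one₀ h1 hγ0.le hγ1
        nlinarith [mul_pos ht qj, mul_nonneg (sub_nonneg.2 this) qi.le]
    have wj : 0 < levelStep d i j t q j := by
      rw [levelStep_apply_right d hij]
      rcases h0.eq_or_lt with rfl | ht
      · linarith
      · nlinarith [mul_pos (mul_pos ht hγ0) qi, mul_nonneg (sub_nonneg.2 h1) qj.le]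
    rw [if_pos wi, if_pos wj, if_pos qi, if_pos qj] at hwt
    linarith

/-! ### Embedding the three-level region among further levels. -/

/-- The vector with entries `u`, `v`, `w` at `a`, `b`, `c` that vanishes at the other levels. -/
def tripleVec {n : ℕ} (a b c : Fin n) (u v w : ℝ) : Fin n → ℝ :=
  Pi.single a u + Pi.single b v + Pi.single c w

theorem tripleVec_swap_right {n : ℕ} (a b c : Fin n) (u v w : ℝ) :
    tripleVec a b c u v w = tripleVec a c b u w v := by
  simp only [tripleVec]; abel

theorem tripleVec_swap_left {n : ℕ} (a b c : Fin n) (u v w : ℝ) :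
    tripleVec a b c u v w = tripleVec b a c v u w := by
  simp only [tripleVec]; abel

theorem tripleVec_apply {n : ℕ} {a b c : Fin n} (hab : a ≠ b) (hac : a ≠ c) (u v w : ℝ) :
    tripleVec a b c u v w a = u := by
  simp [tripleVec, hab, hac]

theorem tripleVec_apply_of_ne {n : ℕ} {a b c k : Fin n} (ha : k ≠ a) (hb : k ≠ b) (hc : k ≠ c)
    (u v w : ℝ) : tripleVec a b c u v w k = 0 := by
  simp [tripleVec, ha, hb, hc]

theorem levelStep_tripleVec {n : ℕ} (d : Fin n → ℝ) {a b c : Fin n} (hab : a ≠ b) (hac : a ≠ c)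
    (hbc : b ≠ c) (t u v w : ℝ) :
    levelStep d a b t (tripleVec a b c u v w) =
      tripleVec a b c (u + t * (v - d b / d a * u)) (v - t * (v - d b / d a * u)) w := by
  have hb : tripleVec a b c u v w b = v := by
    rw [tripleVec_swap_left, tripleVec_apply hab.symm hbc]
  rw [levelStep, tripleVec_apply hab hac, hb]
  ext k
  simp only [tripleVec, Pi.add_apply, Pi.smul_apply, Pi.sub_apply, smul_eq_mul, Pi.single_apply]
  split_ifs <;> ring

theorem tripleVec_comp_swap {n : ℕ} (a b c i j : Fin n) (u v w : ℝ) :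
    tripleVec a b c u v w ∘ Equiv.swap i j =
      tripleVec (Equiv.swap i j a) (Equiv.swap i j b) (Equiv.swap i j c) u v w := by
  ext k
  obtain ⟨l, rfl⟩ := (Equiv.swap i j).surjective k
  simp [tripleVec, Pi.single_apply]

theorem supportWeight_tripleVec {n : ℕ} (d : Fin n → ℝ) {a b c : Fin n} (hab : a ≠ b) (hac : a ≠ c)
    (hbc : b ≠ c) {u v w : ℝ} (hu : 0 < u) (hv : 0 < v) (hw : 0 < w) :
    supportWeight d (tripleVec a b c u v w) = d a + d b + d c := by
  have e : ∀ k, (if 0 < tripleVec a b c u v w k then d k else 0) =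
      tripleVec a b c (d a) (d b) (d c) k := by
    intro k
    by_cases ha : k = a
    · subst ha
      rw [tripleVec_apply hab hac, tripleVec_apply hab hac, if_pos hu]
    by_cases hb : k = b
    · subst hb
      rw [tripleVec_swap_left, tripleVec_apply hab.symm hbc, if_pos hv, tripleVec_swap_left,
        tripleVec_apply hab.symm hbc]
    by_cases hc : k = c
    · subst hc
      rw [tripleVec_swap_right, tripleVec_swap_left, tripleVec_apply hac.symm hbc.symm, if_pos hw,
        tripleVec_swap_right, tripleVec_swap_left, tripleVec_apply hac.symm hbc.symm]
    · rw [tripleVec_apply_of_ne ha hb hc, tripleVec_apply_of_ne ha hb hc, if_neg (lt_irrefl _)]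
  simp only [supportWeight, e]
  simp [tripleVec, Finset.sum_add_distrib]

/-- Three levels of weights `D`, `α * D`, `α * β * D` are occupied, with populations relative to
`κ` that are, up to a multiple of the equilibrium, in `EdgeRegion`. -/
def EdgeConfig {n : ℕ} (d : Fin n → ℝ) (D α β s κ : ℝ) (q : Fin n → ℝ) : Prop :=
  ∃ a b c x y z, d a = D ∧ d b = α * D ∧ d c = α * β * D ∧ EdgeRegion α β s x y z ∧
    q = tripleVec a b c (κ * (x + 1)) (κ * (y + α)) (κ * (z + α * β))

section

variable {n : ℕ} {d : Fin n → ℝ} {D α β s κ : ℝ} {q : Fin n → ℝ}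

theorem ne_of_weights (hD : 0 < D) (hα0 : 0 < α) (hα1 : α < 1) (hβ1 : β < 1)
    {a b c : Fin n} (ha : d a = D) (hb : d b = α * D) (hc : d c = α * β * D) :
    (a ≠ b ∧ a ≠ c ∧ b ≠ c) ∧ d b < d a ∧ d c < d a ∧ d c < d b := by
  have h1 : d b < d a := by rw [ha, hb]; nlinarith
  have h2 : d c < d b := by
    rw [hb, hc]
    nlinarith [mul_pos (mul_pos hα0 hD) (sub_pos.2 hβ1)]
  refine ⟨⟨?_, ?_, ?_⟩, h1, h2.trans h1, h2⟩ <;> rintro rfl <;> linarith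

theorem EdgeRegion.pos {x y z : ℝ} (h : EdgeRegion α β s x y z) (hα0 : 0 < α) (hα1 : α < 1)
    (hβ0 : 0 < β) (hβ1 : β < 1) (hs0 : 0 < s) : 0 < x + 1 ∧ 0 < y + α ∧ 0 < z + α * β := by
  have hαβ : 0 < α * β := mul_pos hα0 hβ0
  have hαβ1 : α * β < 1 := by nlinarith
  have hmu : 0 ≤ (1 - α) * (1 - α * β * (1 - s)) := mul_nonneg (by linarith) (by nlinarith)
  exact ⟨by linarith [h.le_x], by linarith [h.y_nonneg], by linarith [h.z_nonneg]⟩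

theorem EdgeConfig.supportWeight_eq (h : EdgeConfig d D α β s κ q) (hD : 0 < D) (hα0 : 0 < α)
    (hα1 : α < 1) (hβ0 : 0 < β) (hβ1 : β < 1) (hs0 : 0 < s) (hκ : 0 < κ) :
    supportWeight d q = D + α * D + α * β * D := by
  obtain ⟨a, b, c, x, y, z, ha, hb, hc, hR, rfl⟩ := h
  obtain ⟨⟨hab, hac, hbc⟩, -⟩ := ne_of_weights hD hα0 hα1 hβ1 ha hb hc
  obtain ⟨h1, h2, h3⟩ := hR.pos hα0 hα1 hβ0 hβ1 hs0
  rw [supportWeight_tripleVec d hab hac hbc (mul_pos hκ h1) (mul_pos hκ h2) (mul_pos hκ h3), ha, hb,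
    hc]

theorem EdgeConfig.comp_swap (h : EdgeConfig d D α β s κ q) {i j : Fin n} (hij : d i = d j) :
    EdgeConfig d D α β s κ (q ∘ Equiv.swap i j) := by
  have hd : ∀ k, d (Equiv.swap i j k) = d k := by
    intro k
    rw [Equiv.swap_apply_def]
    split_ifs with h1 h2
    · rw [h1, hij]
    · rw [h2, hij]
    · rfl
  obtain ⟨a, b, c, x, y, z, ha, hb, hc, hR, rfl⟩ := h
  exact ⟨_, _, _, x, y, z, (hd a).trans ha, (hd b).trans hb, (hd c).trans hc, hR,
    tripleVec_comp_swap a b c i j _ _ _⟩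

theorem EdgeConfig.levelStep (h : EdgeConfig d D α β s κ q) (hpos : ∀ i, 0 < d i) (hα0 : 0 < α)
    (hα1 : α < 1) (hβ0 : 0 < β) (hβ1 : β < 1) (hs0 : 0 < s) (hs1 : s < 1)
    (hs : s * (1 - α * β) = 1 - α) {i j : Fin n} {t : ℝ} (hd : d j ≤ d i)
    (h0 : 0 ≤ t) (h1 : t ≤ 1) (hij : i ≠ j) (hi : q i ≠ 0) (hj : q j ≠ 0) :
    EdgeConfig d D α β s κ (levelStep d i j t q) := by
  obtain ⟨a, b, c, x, y, z, ha, hb, hc, hR, rfl⟩ := h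
  have hD : 0 < D := ha ▸ hpos a
  obtain ⟨⟨hab, hac, hbc⟩, l1, l2, l3⟩ := ne_of_weights hD hα0 hα1 hβ1 ha hb hc
  have cover : ∀ k, tripleVec a b c (κ * (x + 1)) (κ * (y + α)) (κ * (z + α * β)) k ≠ 0 →
      k = a ∨ k = b ∨ k = c := by
    intro k hk
    by_contra! hne
    exact hk (tripleVec_apply_of_ne hne.1 hne.2.1 hne.2.2 _ _ _)
  have r1 : d b / d a = α := by rw [hb, ha]; field_simp
  have r2 : d c / d a = α * β := by rw [hc, ha]; field_simp
  have r3 : d c / d b = β := by rw [hc, hb]; field_simp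
  rcases cover i hi with rfl | rfl | rfl <;> rcases cover j hj with rfl | rfl | rfl <;>
    first
    | exact absurd rfl hij
    | exact absurd hd (not_le.2 l1)
    | exact absurd hd (not_le.2 l2)
    | exact absurd hd (not_le.2 l3)
    | skip
  · refine ⟨_, _, _, _, _, _, ha, hb, hc, hR.step_xy hα0 hα1 hβ0 hβ1 hs0 h0 h1, ?_⟩
    rw [levelStep_tripleVec d hab hac hbc, r1]
    congr 1 <;> ring
  · refine ⟨_, _, _, _, _, _, ha, hb, hc, hR.step_xz hα0 hα1 hβ0 hβ1 hs0 hs h0 h1, ?_⟩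
    rw [tripleVec_swap_right, levelStep_tripleVec d hac hab hbc.symm, r2, tripleVec_swap_right]
    congr 1 <;> ring
  · refine ⟨_, _, _, _, _, _, ha, hb, hc, hR.step_yz hα0 hα1 hβ0 hβ1 hs1 h0 h1, ?_⟩
    rw [tripleVec_swap_left, tripleVec_swap_right, levelStep_tripleVec d hbc hab.symm hac.symm, r3,
      tripleVec_swap_right, tripleVec_swap_left]
    congr 1 <;> ring

/-- Steps inside the occupied triple preserve the region; steps to empty levels relabel equal
weights or raise the occupied weight for good. -/
theorem EdgeConfig.of_reach (h : EdgeConfig d D α β s κ q) (hpos : ∀ i, 0 < d i) (hα0 : 0 < α)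
    (hα1 : α < 1) (hβ0 : 0 < β) (hβ1 : β < 1) (hs0 : 0 < s) (hs1 : s < 1)
    (hs : s * (1 - α * β) = 1 - α) (hκ : 0 < κ) (hq : ∀ k, 0 ≤ q k) {w : Fin n → ℝ}
    (hr : Reach d q w) :
    D + α * D + α * β * D < supportWeight d w ∨ EdgeConfig d D α β s κ w := by
  have hD : 0 < D := by
    obtain ⟨a, -, -, -, -, -, ha, -⟩ := h
    exact ha ▸ hpos a
  refine (hr.invariant (fun w => (∀ k, 0 ≤ w k) ∧ (D + α * D + α * β * D < supportWeight d w ∨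
    EdgeConfig d D α β s κ w)) ?_ ⟨hq, Or.inr h⟩).2
  rintro v i j t hd h0 h1 ⟨hv, hor⟩
  refine ⟨levelStep_nonneg hpos hd h0 h1 hv, ?_⟩
  rcases hor with hlt | hc
  · exact Or.inl (hlt.trans_le (supportWeight_le_levelStep hpos hd h0 h1 hv))
  rcases eq_or_ne i j with rfl | hij
  · rw [levelStep_self]; exact Or.inr hc
  by_cases hz : v i = 0 ∨ v j = 0
  · rcases levelStep_eq_or_supportWeight_lt hpos hij hd h0 h1 hv hz with e | ⟨e', e⟩ | e
    · rw [e]; exact Or.inr hc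
    · rw [e]; exact Or.inr (hc.comp_swap e')
    · left
      rwa [hc.supportWeight_eq hD hα0 hα1 hβ0 hβ1 hs0 hκ] at e
  · push Not at hz
    exact Or.inr (hc.levelStep hpos hα0 hα1 hβ0 hβ1 hs0 hs1 hs hd h0 h1 hij hz.1 hz.2)

end

/-! ### The counterexample to convexity and the conclusion. -/

theorem not_convex_wetoReachable_of_lt {n : ℕ} {d : Fin n → ℝ} (hpos : ∀ i, 0 < d i)
    {a b c : Fin n} (hba : d b < d a) (hcb : d c < d b) :
    ∃ p ∈ stdSimplex ℝ (Fin n), ¬ Convex ℝ (wetoReachable d p) := by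
  have hab : a ≠ b := by rintro rfl; exact lt_irrefl _ hba
  have hbc : b ≠ c := by rintro rfl; exact lt_irrefl _ hcb
  have hac : a ≠ c := by rintro rfl; exact lt_irrefl _ (hba.trans hcb)
  have hda := hpos a
  have hdb := hpos b
  have hdc := hpos c
  obtain ⟨α, hα⟩ : ∃ α, α = d b / d a := ⟨_, rfl⟩
  obtain ⟨β, hβ⟩ : ∃ β, β = d c / d b := ⟨_, rfl⟩
  have hα0 : 0 < α := hα ▸ div_pos hdb hda
  have hα1 : α < 1 := by rw [hα]; exact (div_lt_one hda).2 hba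
  have hβ0 : 0 < β := hβ ▸ div_pos hdc hdb
  have hβ1 : β < 1 := by rw [hβ]; exact (div_lt_one hdb).2 hcb
  have hαβ : 0 < α * β := mul_pos hα0 hβ0
  have hαβα : α * β < α := by nlinarith
  have e1 : d b = α * d a := by rw [hα]; field_simp
  have e2 : d c = α * β * d a := by rw [hα, hβ]; field_simp
  have r2 : d c / d a = α * β := by rw [hα, hβ]; field_simp
  obtain ⟨s, hsdef⟩ : ∃ s, s = (1 - α) / (1 - α * β) := ⟨_, rfl⟩
  have hden : 0 < 1 - α * β := by linarith
  have hs0 : 0 < s := hsdef ▸ div_pos (by linarith) hden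
  have hs1 : s < 1 := by rw [hsdef, div_lt_one hden]; linarith
  have hs : s * (1 - α * β) = 1 - α := by rw [hsdef]; field_simp
  have hN : 0 < 2 + α + α * β + α * β * s := by positivity
  obtain ⟨κ, hκdef⟩ : ∃ κ, κ = (2 + α + α * β + α * β * s)⁻¹ := ⟨_, rfl⟩
  have hκ : 0 < κ := hκdef ▸ inv_pos.2 hN
  -- The equilibrium `(1, α, α * β)`, fixed by swaps within the triple, is added to `(1, 0, α * β *
  -- s)` so that all three levels stay occupied; `κ` normalises the total.
  obtain ⟨p, hp⟩ : ∃ p, p = tripleVec a b c (κ * (1 + 1)) (κ * (0 + α))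
    (κ * (α * β * s + α * β)) := ⟨_, rfl⟩
  have hp0 : ∀ k, 0 ≤ p k := by
    intro k
    have h1 : 0 ≤ κ * (1 + 1) := by positivity
    have h2 : 0 ≤ κ * (0 + α) := by positivity
    have h3 : 0 ≤ κ * (α * β * s + α * β) := by positivity
    simp only [hp, tripleVec, Pi.add_apply, Pi.single_apply]
    refine add_nonneg (add_nonneg ?_ ?_) ?_ <;> split_ifs <;> first | assumption | exact le_rfl
  have hpS : p ∈ stdSimplex ℝ (Fin n) := by
    refine ⟨hp0, ?_⟩
    have : κ * (2 + α + α * β + α * β * s) = 1 := by rw [hκdef]; exact inv_mul_cancel₀ hN.ne'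
    simp only [hp, tripleVec, Pi.add_apply, Finset.sum_add_distrib, Finset.sum_pi_single']
    simp only [Finset.mem_univ, if_true]
    linear_combination this
  refine ⟨p, hpS, fun hconv => ?_⟩
  rw [wetoReachable_eq_setOf_reach hpos hpS] at hconv
  have step : ∀ {i j k : Fin n} {u v w : ℝ}, i ≠ j → i ≠ k → j ≠ k → d j < d i →
      Reach d (tripleVec i j k u v w)
        (tripleVec i j k (u + 1 * (v - d j / d i * u)) (v - 1 * (v - d j / d i * u)) w) := by
    intro i j k u v w hij hik hjk hlt
    rw [← levelStep_tripleVec d hij hik hjk]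
    exact Reach.of_levelStep hlt.le zero_le_one le_rfl _
  have step_ab := fun u v w => step (u := u) (v := v) (w := w) hab hac hbc hba
  have step_ac := fun u v w => step (u := u) (v := v) (w := w) hac hab hbc.symm (hcb.trans hba)
  have step_bc := fun u v w => step (u := u) (v := v) (w := w) hbc hab.symm hac.symm hcb
  simp only [← hα, ← hβ, r2] at step_ab step_ac step_bc
  have step_ac' : ∀ u v w, Reach d (tripleVec a b c u v w) (tripleVec a b c
      (u + 1 * (w - α * β * u)) v (w - 1 * (w - α * β * u))) := by
    intro u v w
    have := step_ac u w v
    rwa [tripleVec_swap_right a c b, tripleVec_swap_right a c b] at this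
  have step_bc' : ∀ u v w, Reach d (tripleVec a b c u v w) (tripleVec a b c
      u (v + 1 * (w - β * v)) (w - 1 * (w - β * v))) := by
    intro u v w
    have := step_bc v w u
    rwa [tripleVec_swap_right b c a, tripleVec_swap_right b c a, tripleVec_swap_left b a c,
      tripleVec_swap_left b a c] at this
  have congr_reach : ∀ {u v w u' v' w' : ℝ}, Reach d p (tripleVec a b c u v w) → u = u' → v = v' →
      w = w' → Reach d p (tripleVec a b c u' v' w') := by
    rintro u v w _ _ _ h rfl rfl rfl
    exact h
  have reach₀ : Reach d p (tripleVec a b c (κ * (1 + 1)) (κ * (0 + α))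
      (κ * (α * β * s + α * β))) := by
    rw [hp]; exact Relation.ReflTransGen.refl
  have reach₁ : Reach d p (tripleVec a b c (κ * (1 - α + 1)) (κ * (α + α))
      (κ * (α * β * s + α * β))) :=
    congr_reach (reach₀.trans (step_ab _ _ _)) (by ring) (by ring) rfl
  -- The second endpoint of the edge arises from the full swaps of `a, c`, then `a, b`, then `b, c`.
  have reach₂ : Reach d p (tripleVec a b c (κ * ((1 - α) * (1 - α * β * (1 - s)) + 1))
      (κ * (α * (1 - (1 - β) * (α * β * (1 - s))) + α))
      (κ * (α * β * (1 - α * β * (1 - s)) + α * β))) :=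
    congr_reach (((reach₀.trans (step_ac' _ _ _)).trans (step_ab _ _ _)).trans (step_bc' _ _ _))
      (by ring) (by ring) (by ring)
  obtain ⟨x, hx⟩ : ∃ x, x = (1 - α + (1 - α) * (1 - α * β * (1 - s))) / 2 := ⟨_, rfl⟩
  obtain ⟨y, hy⟩ : ∃ y, y = (α + α * (1 - (1 - β) * (α * β * (1 - s)))) / 2 := ⟨_, rfl⟩
  obtain ⟨z, hz⟩ : ∃ z, z = (α * β * s + α * β * (1 - α * β * (1 - s))) / 2 := ⟨_, rfl⟩
  have hmid : Reach d p (tripleVec a b c (κ * (x + 1)) (κ * (y + α)) (κ * (z + α * β))) := by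
    have := hconv reach₁ reach₂ (a := 1 / 2) (b := 1 / 2) (by norm_num) (by norm_num) (by norm_num)
    have e : ∀ u v w u' v' w' : ℝ, (1 / 2 : ℝ) • tripleVec a b c u v w +
        (1 / 2 : ℝ) • tripleVec a b c u' v' w' =
        tripleVec a b c ((u + u') / 2) ((v + v') / 2) ((w + w') / 2) := by
      intro u v w u' v' w'
      ext k
      simp only [tripleVec, Pi.add_apply, Pi.smul_apply, smul_eq_mul, Pi.single_apply]
      split_ifs <;> ring
    rw [e] at this
    exact congr_reach this (by rw [hx]; ring) (by rw [hy]; ring) (by rw [hz]; ring)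
  have hδ1 : α * β * (1 - s) < 1 := by nlinarith
  have hδ0 : 0 < α * β * (1 - s) := mul_pos hαβ (by linarith)
  have hβδ : 0 < α * ((1 - β) * (α * β * (1 - s))) :=
    mul_pos hα0 (mul_pos (by linarith) hδ0)
  have hx0 : 0 < κ * (x + 1) := by
    have := mul_nonneg (sub_nonneg.2 hα1.le) (sub_nonneg.2 hδ1.le)
    refine mul_pos hκ ?_
    linarith
  have hy0 : 0 < κ * (y + α) := by
    refine mul_pos hκ ?_
    nlinarith
  have hz0 : 0 < κ * (z + α * β) := by
    have := mul_pos hαβ hs0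
    have := mul_pos hαβ (sub_pos.2 hδ1)
    refine mul_pos hκ ?_
    linarith
  have hstart : EdgeConfig d (d a) α β s κ p :=
    ⟨a, b, c, _, _, _, rfl, e1, e2, EdgeRegion.start hα0 hα1 hβ0 hβ1 hs0 hs1, hp⟩
  rcases hstart.of_reach hpos hα0 hα1 hβ0 hβ1 hs0 hs1 hs hκ hp0 hmid with hlt | hcfg
  · rw [supportWeight_tripleVec d hab hac hbc hx0 hy0 hz0] at hlt
    linarith
  · obtain ⟨a', b', c', x', y', z', ha', hb', hc', hR, he⟩ := hcfg
    obtain ⟨⟨hab', hac', hbc'⟩, -⟩ := ne_of_weights hda hα0 hα1 hβ1 ha' hb' hc'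
    obtain ⟨-, p2, p3⟩ := hR.pos hα0 hα1 hβ0 hβ1 hs0
    have cover : ∀ k, tripleVec a b c (κ * (x + 1)) (κ * (y + α)) (κ * (z + α * β)) k ≠ 0 →
        k = a ∨ k = b ∨ k = c := by
      intro k hk
      by_contra! hne
      exact hk (tripleVec_apply_of_ne hne.1 hne.2.1 hne.2.2 _ _ _)
    have fb := congrFun he b'
    have fc := congrFun he c'
    rw [tripleVec_swap_left a' b' c', tripleVec_apply hab'.symm hbc'] at fb
    rw [tripleVec_swap_right a' b' c', tripleVec_swap_left a' c' b',
      tripleVec_apply hac'.symm hbc'.symm] at fc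
    -- The triple may have been relabelled, but its support and its distinct weights identify the
    -- levels; the level `a'` is not needed, as the functional ignores its entry.
    have eb : b' = b := by
      rcases cover b' (by rw [fb]; exact (mul_pos hκ p2).ne') with h | h | h
      · rw [h] at hb'; linarith
      · exact h
      · rw [h] at hb'; linarith
    have ec : c' = c := by
      rcases cover c' (by rw [fc]; exact (mul_pos hκ p3).ne') with h | h | h
      · rw [h] at hc'; linarith
      · rw [h] at hc'; linarith
      · exact h
    rw [eb, tripleVec_swap_left a b c, tripleVec_apply hab.symm hbc] at fb
    rw [ec, tripleVec_swap_right a b c, tripleVec_swap_left a c b,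
      tripleVec_apply hac.symm hbc.symm] at fc
    have hy' : y' = y := by linarith [mul_left_cancel₀ hκ.ne' fb]
    have hz' : z' = z := by linarith [mul_left_cancel₀ hκ.ne' fc]
    -- The functional takes the same maximal value at both endpoints, hence at the midpoint, whose
    -- `y` lies strictly between theirs by `hβδ`.
    rcases hR.endpoint (by rw [hy', hz', hy, hz]; simp only [edgeFunctional]; ring) with h | h
    · linarith
    · linarith

theorem exists_lt_lt_of_not_isQuasiUniform {n : ℕ} {d : Fin n → ℝ} (h : ¬ IsQuasiUniform d) :
    ∃ a b c, d b < d a ∧ d c < d b := by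
  simp only [IsQuasiUniform, not_exists, not_forall, not_or] at h
  -- The values `0 0` are arbitrary; they only supply an index.
  obtain ⟨i, -, -⟩ := h 0 0
  obtain ⟨j, hj, -⟩ := h (d i) (d i)
  obtain ⟨k, hki, hkj⟩ := h (d i) (d j)
  rcases lt_or_gt_of_ne hj with h1 | h1 <;> rcases lt_or_gt_of_ne hki with h2 | h2 <;>
    rcases lt_or_gt_of_ne hkj with h3 | h3
  · exact ⟨i, j, k, h1, h3⟩
  · exact ⟨i, k, j, h2, h3⟩
  · exact absurd (h3.trans (h1.trans h2)) (lt_irrefl _)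
  · exact ⟨k, i, j, h2, h1⟩
  · exact ⟨j, i, k, h1, h2⟩
  · exact absurd (h3.trans (h2.trans h1)) (lt_irrefl _)
  · exact ⟨j, k, i, h3, h2⟩
  · exact ⟨k, j, i, h3, h1⟩

theorem mainTheorem10 {n : ℕ} (d : Fin n → ℝ) (hd : d ∈ stdSimplex ℝ (Fin n))
    (hpos : ∀ i, 0 < d i) :
    ((∀ p ∈ stdSimplex ℝ (Fin n), Convex ℝ (wetoReachable d p)) → IsQuasiUniform d) ∧
    (n = 3 →
      ((∀ p ∈ stdSimplex ℝ (Fin n), Convex ℝ (wetoReachable d p)) ↔ IsQuasiUniform d)) := by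
  have necessary : (∀ p ∈ stdSimplex ℝ (Fin n), Convex ℝ (wetoReachable d p)) →
      IsQuasiUniform d := by
    intro h
    by_contra hq
    obtain ⟨a, b, c, hba, hcb⟩ := exists_lt_lt_of_not_isQuasiUniform hq
    obtain ⟨p, hp, hp'⟩ := not_convex_wetoReachable_of_lt hpos hba hcb
    exact hp' (h p hp)
  refine ⟨necessary, ?_⟩
  rintro rfl
  exact ⟨necessary, fun h p hp => h.convex_wetoReachable hpos hp⟩
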